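/- Theorem 7.1. Let $G$ be an infinite simple graph that is not locally finite, that is, some vertex of $G$ has infinite degree. Regard $G$ as a topological space, its 1-complex: every edge $e=xy$ is a homeomorphic copy $[x,y]$ of the unit interval $[0,1]$, edges meet only in common endvertices, a set is open if and only if its intersection with every edge is open in that edge (so a basic open neighbourhood of a vertex $v$ is a union of half-open intervals $[v,i_e)$, one for every edge $e$ at $v$, with each $i_e$ an arbitrary inner point of $e$; isolated vertices are open). A compactification of $G$ is a compact (not necessarily Hausdorff) topological space $K$ that contains $G$ as a dense subspace, and $K\setminus G$ is its remainder. Then no compactification of $G$ is both Hausdorff and has a totally disconnected remainder. -/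

import Mathlib

namespace SimpleGraph

/-- The identifications that produce the 1-complex of `G` from the disjoint union of the vertex
set and of one copy `{d} × [0, 1]` of the unit interval for every orientation `d` of every edge:
the starting point of `{d} × [0, 1]` is the tail `d.fst` of `d`, and the two intervals belonging
to the two orientations of one edge are identified by `t ↦ 1 - t`. (Hence the end point of
`{d} × [0, 1]` is the head `d.snd`.) -/
inductive OneComplexRel {V : Type*} (G : SimpleGraph V) :
    V ⊕ (G.Dart × unitInterval) → V ⊕ (G.Dart × unitInterval) → Prop
  | start (d : G.Dart) : OneComplexRel G (Sum.inr (d, 0)) (Sum.inl d.fst)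
  | flip (d : G.Dart) (t : unitInterval) :
      OneComplexRel G (Sum.inr (d, t)) (Sum.inr (d.symm, unitInterval.symm t))

/-- The point set of the 1-complex of `G`: the vertices, and a copy of `(0, 1)` for every edge. -/
def OneComplex {V : Type*} (G : SimpleGraph V) : Type _ :=
  Quot (OneComplexRel G)

namespace OneComplex

/-- A vertex, as a point of the 1-complex. -/
def vertex {V : Type*} (G : SimpleGraph V) (v : V) : G.OneComplex :=
  Quot.mk _ (Sum.inl v)

/-- The parametrization `[0, 1] → G` of an edge, run through in the direction of `d`. -/
def edgePoint {V : Type*} (G : SimpleGraph V) (d : G.Dart) (t : unitInterval) : G.OneComplex :=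
  Quot.mk _ (Sum.inr (d, t))

/-- The topology of the 1-complex is the quotient topology (the vertex set being discrete), that
is, the finest topology for which all parametrizations of edges are continuous. In particular the
open neighbourhoods of a vertex `v` may contain arbitrarily short initial segments of the edges at
`v`, chosen independently of each other. -/
instance instTopologicalSpace {V : Type*} (G : SimpleGraph V) : TopologicalSpace G.OneComplex :=
  ⨆ d : G.Dart, TopologicalSpace.coinduced (edgePoint G d) inferInstance

theorem isOpen_iff {V : Type*} (G : SimpleGraph V) (s : Set G.OneComplex) :
    IsOpen s ↔ ∀ d : G.Dart, IsOpen (edgePoint G d ⁻¹' s) := by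
  rw [isOpen_iSup_iff]
  exact forall_congr' fun d => isOpen_coinduced

end OneComplex

end SimpleGraph

/-- `ι : X → K` is a compactification of `X`: a topological embedding of `X` onto a dense subspace
of the compact space `K`, which need not be Hausdorff. -/
structure IsCompactification {X K : Type*} [TopologicalSpace X] [TopologicalSpace K]
    (ι : X → K) : Prop where
  compactSpace : CompactSpace K
  isDenseEmbedding : IsDenseEmbedding ι

open Filter Topology

/-! Suppose `K` is Hausdorff with totally disconnected remainder, and let `U` be a nonprincipal
ultrafilter on the edges at a vertex `v` of infinite degree. The points at parameter `c` on these
edges have a `U`-limit `x` in the remainder. Separate `v` from `x` by `O` and `Q`, and choose on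
each edge a point at `f d ≤ c` inside `O`. The `U`-limit of the segments `[f d, c]` is connected
(`isPreconnected_ultraLimsup`) and avoids `G` (`ultraLimsup_subset_compl_range`), so it is a single
point. Hence the chosen points also tend to `x` and enter `Q`, a contradiction. -/

/-- The points of `K` all of whose neighbourhoods meet `U`-many of the sets `I a`. -/
def ultraLimsup {α K : Type*} [TopologicalSpace K] (U : Ultrafilter α) (I : α → Set K) : Set K :=
  {y | ∀ A ∈ U, y ∈ closure (⋃ a ∈ A, I a)}

theorem isClosed_ultraLimsup {α K : Type*} [TopologicalSpace K] (U : Ultrafilter α)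
    (I : α → Set K) : IsClosed (ultraLimsup U I) := by
  simp only [ultraLimsup, Set.ofPred_forall]
  exact isClosed_iInter fun A => isClosed_iInter fun _ => isClosed_closure

theorem mem_ultraLimsup_of_tendsto {α K : Type*} [TopologicalSpace K] {U : Ultrafilter α}
    {I : α → Set K} {u : α → K} (hu : ∀ a, u a ∈ I a) {x : K} (hx : Tendsto u U (𝓝 x)) :
    x ∈ ultraLimsup U I := fun _ hA =>
  mem_closure_of_tendsto hx <| mem_of_superset hA fun a ha => Set.mem_biUnion ha (hu a)

/-- Compactness: otherwise the traces on `Oᶜ` of the closures form a directed family of nonempty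
compact sets, with a common point. -/
theorem exists_mem_biUnion_subset_of_ultraLimsup_subset {α K : Type*} [TopologicalSpace K]
    [CompactSpace K] {U : Ultrafilter α} {I : α → Set K} {O : Set K} (hO : IsOpen O)
    (h : ultraLimsup U I ⊆ O) : ∃ A ∈ U, ⋃ a ∈ A, I a ⊆ O := by
  by_contra! hne
  have hne' : ∀ A ∈ U, ((⋃ a ∈ A, I a) ∩ Oᶜ).Nonempty := by
    intro A hA
    obtain ⟨y, hy, hyO⟩ := Set.not_subset.1 (hne A hA)
    exact ⟨y, hy, hyO⟩
  have hcl : (⋂ A : {A // A ∈ U}, closure (⋃ a ∈ A.1, I a) ∩ Oᶜ).Nonempty := by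
    have : Nonempty {A // A ∈ U} := ⟨⟨Set.univ, univ_mem⟩⟩
    refine IsCompact.nonempty_iInter_of_directed_nonempty_isCompact_isClosed _ ?_ ?_ ?_ ?_
    · intro A B
      refine ⟨⟨A.1 ∩ B.1, inter_mem A.2 B.2⟩, ?_, ?_⟩
      · exact Set.inter_subset_inter_left _
          (closure_mono (Set.biUnion_subset_biUnion_left Set.inter_subset_left))
      · exact Set.inter_subset_inter_left _
          (closure_mono (Set.biUnion_subset_biUnion_left Set.inter_subset_right))
    · exact fun A => (hne' A.1 A.2).mono (Set.inter_subset_inter_left _ subset_closure)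
    · exact fun A => (isClosed_closure.inter hO.isClosed_compl).isCompact
    · exact fun A => isClosed_closure.inter hO.isClosed_compl
  obtain ⟨y, hy⟩ := hcl
  rw [Set.mem_iInter] at hy
  exact (hy ⟨Set.univ, univ_mem⟩).2 (h fun A hA => (hy ⟨A, hA⟩).1)

/-- In a compact Hausdorff space, the limit of preconnected sets along an ultrafilter is
preconnected. -/
theorem isPreconnected_ultraLimsup {α K : Type*} [TopologicalSpace K] [CompactSpace K] [T2Space K]
    (U : Ultrafilter α) {I : α → Set K} (hI : ∀ a, IsPreconnected (I a)) :
    IsPreconnected (ultraLimsup U I) := by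
  have key : ∀ O₁ O₂ : Set K, IsOpen O₂ → Disjoint O₁ O₂ → {a | I a ⊆ O₁} ∈ U →
      ∀ x ∈ ultraLimsup U I, x ∉ O₂ := by
    intro O₁ O₂ h₂ hd hU x hx hx₂
    obtain ⟨y, hy₂, hy⟩ := mem_closure_iff.1 (hx _ hU) O₂ h₂ hx₂
    obtain ⟨a, ha, hya⟩ := Set.mem_iUnion₂.1 hy
    exact Set.disjoint_left.1 hd (ha hya) hy₂
  rw [isPreconnected_iff_subset_of_fully_disjoint_closed (isClosed_ultraLimsup U I)]
  intro C₁ C₂ hC₁ hC₂ hsub hd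
  obtain ⟨O₁, O₂, hO₁, hO₂, h₁, h₂, hO⟩ := normal_separation hC₁ hC₂ hd
  obtain ⟨A, hA, hAsub⟩ := exists_mem_biUnion_subset_of_ultraLimsup_subset (hO₁.union hO₂)
    (hsub.trans (Set.union_subset_union h₁ h₂))
  -- Each connected `I a` chooses a side, and `U` makes one side prevail.
  have hor : {a | I a ⊆ O₁} ∪ {a | I a ⊆ O₂} ∈ U := by
    refine mem_of_superset hA fun a ha => ?_
    exact (hI a).subset_or_subset hO₁ hO₂ hO ((Set.subset_biUnion_of_mem ha).trans hAsub)
  rcases Ultrafilter.union_mem_iff.1 hor with h | h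
  · exact Or.inl fun x hx => (hsub hx).resolve_right fun hx₂ =>
      key O₁ O₂ hO₂ hO h x hx (h₂ hx₂)
  · exact Or.inr fun x hx => (hsub hx).resolve_left fun hx₁ =>
      key O₂ O₁ hO₁ hO.symm h x hx (h₁ hx₁)

namespace SimpleGraph.OneComplex

variable {V : Type*} {G : SimpleGraph V}

theorem continuous_edgePoint (d : G.Dart) : Continuous (edgePoint G d) :=
  continuous_def.2 fun s hs => (isOpen_iff G s).1 hs d

theorem isClosed_iff (s : Set G.OneComplex) :
    IsClosed s ↔ ∀ d : G.Dart, IsClosed (edgePoint G d ⁻¹' s) := by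
  simp only [← isOpen_compl_iff, isOpen_iff, Set.preimage_compl]

theorem edgePoint_zero (d : G.Dart) : edgePoint G d 0 = vertex G d.fst :=
  Quot.sound (.start d)

/-- The union of the segments `[f d, g d]` of the oriented edges `d ∈ A`, for `0 < f` and
`g < 1`. -/
def band (A : Set G.Dart) (f g : G.Dart → unitInterval) (hf : ∀ d, 0 < f d) (hg : ∀ d, g d < 1) :
    Set G.OneComplex :=
  {p | Quot.lift (r := OneComplexRel G)
    (Sum.elim (fun _ => False) fun q : G.Dart × unitInterval =>
      (q.1 ∈ A ∧ q.2 ∈ Set.Icc (f q.1) (g q.1)) ∨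
        (q.1.symm ∈ A ∧ unitInterval.symm q.2 ∈ Set.Icc (f q.1.symm) (g q.1.symm)))
    (by
      -- The strict bounds exclude both ends of every edge, so no vertex is hit.
      rintro _ _ (d | ⟨d, t⟩)
      · simp [(hf d).not_ge, (hg d.symm).not_ge]
      · simp [or_comm]) p}

section band

variable {A : Set G.Dart} {f g : G.Dart → unitInterval} {hf : ∀ d, 0 < f d} {hg : ∀ d, g d < 1}

theorem vertex_notMem_band (w : V) : vertex G w ∉ band A f g hf hg := id

theorem edgePoint_mem_band {d : G.Dart} {t : unitInterval} :
    edgePoint G d t ∈ band A f g hf hg ↔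
      (d ∈ A ∧ t ∈ Set.Icc (f d) (g d)) ∨
        (d.symm ∈ A ∧ unitInterval.symm t ∈ Set.Icc (f d.symm) (g d.symm)) :=
  Iff.rfl

theorem isClosed_band : IsClosed (band A f g hf hg) := by
  refine (isClosed_iff _).2 fun d => ?_
  have h₁ : IsClosed {t | d ∈ A ∧ t ∈ Set.Icc (f d) (g d)} := isClosed_const.and isClosed_Icc
  have h₂ : IsClosed
      {t | d.symm ∈ A ∧ unitInterval.symm t ∈ Set.Icc (f d.symm) (g d.symm)} :=
    isClosed_const.and (isClosed_Icc.preimage unitInterval.continuous_symm)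
  exact h₁.union h₂

end band

/-- Discarding the two orientations of the edge carrying an inner point suffices. -/
theorem exists_finite_notMem_band {f g : G.Dart → unitInterval} (hf : ∀ d, 0 < f d)
    (hg : ∀ d, g d < 1) (p : G.OneComplex) :
    ∃ F : Set G.Dart, F.Finite ∧ p ∉ band Fᶜ f g hf hg := by
  obtain ⟨w | ⟨d, t⟩, rfl⟩ := Quot.exists_rep p
  · exact ⟨∅, Set.finite_empty, vertex_notMem_band w⟩
  · refine ⟨{d, d.symm}, Set.toFinite _, fun h => ?_⟩
    rcases edgePoint_mem_band.1 h with h | h <;> simp at h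

/-- Inner segments of infinitely many edges accumulate only outside of the 1-complex. -/
theorem ultraLimsup_subset_compl_range {K : Type*} [TopologicalSpace K] {ι : G.OneComplex → K}
    (hι : IsInducing ι) {U : Ultrafilter G.Dart} (hU : (U : Filter G.Dart) ≤ cofinite)
    {f g : G.Dart → unitInterval} (hf : ∀ d, 0 < f d) (hg : ∀ d, g d < 1) :
    ultraLimsup U (fun d => ι '' (edgePoint G d '' Set.Icc (f d) (g d))) ⊆ (Set.range ι)ᶜ := by
  rintro _ hx ⟨p, rfl⟩
  obtain ⟨F, hF, hp⟩ := exists_finite_notMem_band hf hg p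
  refine hp ?_
  rw [← isClosed_band.closure_eq, hι.closure_eq_preimage_closure_image]
  refine closure_mono ?_ (hx Fᶜ (hU hF.compl_mem_cofinite))
  refine Set.iUnion₂_subset fun d hd => Set.image_mono ?_
  rintro _ ⟨t, ht, rfl⟩
  exact edgePoint_mem_band.2 (Or.inl ⟨hd, ht⟩)

theorem infinite_setOf_dart_fst_eq {v : V} (hv : (G.neighborSet v).Infinite) :
    {d : G.Dart | d.fst = v}.Infinite := by
  have : Infinite (G.neighborSet v) := hv.to_subtype
  refine (Set.infinite_range_of_injective (G.dartOfNeighborSet_injective v)).mono ?_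
  rintro _ ⟨w, rfl⟩
  rfl

/-- A neighbourhood of a vertex contains an inner point of the first half of every edge there. -/
theorem exists_pos_le_edgePoint_mem {O : Set G.OneComplex} (hO : IsOpen O) (d : G.Dart)
    (hd : vertex G d.fst ∈ O) {c : unitInterval} (hc : 0 < c) :
    ∃ t, 0 < t ∧ t ≤ c ∧ edgePoint G d t ∈ O := by
  have h0 : edgePoint G d ⁻¹' O ∈ 𝓝[>] (0 : unitInterval) :=
    nhdsWithin_le_nhds <| (continuous_edgePoint d).continuousAt.preimage_mem_nhds <|
      hO.mem_nhds (by rwa [edgePoint_zero])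
  have : (𝓝[>] (0 : unitInterval)).NeBot := nhdsGT_neBot_of_exists_gt ⟨c, hc⟩
  obtain ⟨t, ht, ht'⟩ := nonempty_of_mem (inter_mem h0 (Ioc_mem_nhdsGT hc))
  exact ⟨t, ht'.1, ht'.2, ht⟩

end SimpleGraph.OneComplex

open SimpleGraph OneComplex in
theorem theorem7p1 {V : Type*} [Infinite V] (G : SimpleGraph V)
    (hG : ¬ Nonempty G.LocallyFinite) {K : Type*} [TopologicalSpace K]
    (ι : G.OneComplex → K) (hι : IsCompactification ι) :
    ¬ (T2Space K ∧ IsTotallyDisconnected (Set.range ι)ᶜ) := by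
  rintro ⟨hT2, hR⟩
  have := hι.compactSpace
  obtain ⟨v, hv⟩ : ∃ v, (G.neighborSet v).Infinite := by
    by_contra! h
    exact hG ⟨fun v => (h v).fintype⟩
  have := (infinite_setOf_dart_fst_eq hv).cofinite_inf_principal_neBot
  let U : Ultrafilter G.Dart := Ultrafilter.of (cofinite ⊓ 𝓟 {d : G.Dart | d.fst = v})
  have hU : (U : Filter G.Dart) ≤ cofinite ⊓ 𝓟 {d : G.Dart | d.fst = v} := Ultrafilter.of_le _
  have hUv : ∀ᶠ d in (U : Filter G.Dart), d.fst = v := le_principal_iff.1 (hU.trans inf_le_right)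
  obtain ⟨c, hc0, hc1⟩ : ∃ c : unitInterval, 0 < c ∧ c < 1 := exists_between zero_lt_one
  have hlim : ∀ u : G.Dart → K, ∃ x, Tendsto u U (𝓝 x) := fun u => by
    obtain ⟨x, -, hx⟩ := isCompact_univ.ultrafilter_le_nhds (U.map u) (by simp)
    exact ⟨x, hx⟩
  have hsub : ∀ f : G.Dart → unitInterval, (∀ d, 0 < f d) →
      ultraLimsup U (fun d => ι '' (edgePoint G d '' Set.Icc (f d) c)) ⊆ (Set.range ι)ᶜ :=
    fun f hf =>
    ultraLimsup_subset_compl_range hι.isDenseEmbedding.isInducing (hU.trans inf_le_left) hf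
      (g := fun _ => c) fun _ => hc1
  obtain ⟨x, hx⟩ := hlim fun d => ι (edgePoint G d c)
  have hxv : ι (vertex G v) ≠ x := fun h =>
    hsub (fun _ => c) (fun _ => hc0) (mem_ultraLimsup_of_tendsto
      (fun d => Set.mem_image_of_mem ι
        (Set.mem_image_of_mem (edgePoint G d) (Set.mem_Icc.2 ⟨le_rfl, le_rfl⟩))) hx) ⟨_, h⟩
  obtain ⟨O, Q, hO, hQ, hvO, hxQ, hOQ⟩ := t2_separation hxv
  -- Off `v` the value `c` is a dummy; `U` ignores those darts.
  have hf : ∀ d : G.Dart, ∃ t, 0 < t ∧ t ≤ c ∧ (d.fst = v → ι (edgePoint G d t) ∈ O) := by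
    intro d
    by_cases hd : d.fst = v
    · obtain ⟨t, h0, h1, h2⟩ := exists_pos_le_edgePoint_mem
        (hO.preimage hι.isDenseEmbedding.continuous) d (by rwa [hd]) hc0
      exact ⟨t, h0, h1, fun _ => h2⟩
    · exact ⟨c, hc0, le_rfl, fun h => absurd h hd⟩
  choose f hf0 hfc hfO using hf
  obtain ⟨y, hy⟩ := hlim fun d => ι (edgePoint G d (f d))
  have hconn := isPreconnected_ultraLimsup U fun d : G.Dart =>
    ((isPreconnected_Icc (a := f d) (b := c)).image _
      (continuous_edgePoint d).continuousOn).image _ hι.isDenseEmbedding.continuous.continuousOn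
  have hxy : y = x := hR _ (hsub f hf0) hconn
    (mem_ultraLimsup_of_tendsto (fun d => Set.mem_image_of_mem ι
        (Set.mem_image_of_mem (edgePoint G d) (Set.mem_Icc.2 ⟨le_rfl, hfc d⟩))) hy)
    (mem_ultraLimsup_of_tendsto (fun d => Set.mem_image_of_mem ι
        (Set.mem_image_of_mem (edgePoint G d) (Set.mem_Icc.2 ⟨hfc d, le_rfl⟩))) hx)
  obtain ⟨d, hdQ, hd⟩ := ((hy.eventually (hQ.mem_nhds (hxy ▸ hxQ))).and hUv).exists
  exact Set.disjoint_left.1 hOQ (hfO d hd) hdQ
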